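/- Let $f:\mathbb{P}^1\to\mathbb{P}^1$ be a rational map over $\mathbb{C}$ of degree $d>1$. Suppose that there are an integer $k\ge 1$, a non-zero meromorphic section $q$ of $\Omega_{\mathbb{P}^1}^{\otimes k}$ and a constant $\lambda\in\mathbb{C}^*$ such that $f^*q=\lambda q$. Let $\deg_y f$ denote the local degree of $f$ at $y$, let $\mathrm{Ram}_f=\{y:\deg_y f>1\}$, and let $P_f=\bigcup_{n>0}f^n(\mathrm{Ram}_f)$ be the post-critical set. Let $\nu_f:\mathbb{P}^1\to\{1,2,3,\dots\}\cup\{\infty\}$ be the (pointwise) smallest function $\nu$ such that $\nu(x)=1$ for $x\notin P_f$ and $\nu(f(y))$ is a multiple of $\nu(y)\deg_y f$ for all $y\in\mathbb{P}^1$ (every weight divides $\infty$, and $\infty$ divides only $\infty$). Then: 1. $P_f$ is finite, and $\nu_f$ exists. 2. $f$ preserves the orbifold (with boundary, if the weight $\infty$ occurs) $(\mathbb{P}^1,\nu_f)$, i.e. it lifts to a map of orbifolds: $\nu_f(f(y))$ divides $\nu_f(y)\deg_y f$ for all $y\in\mathbb{P}^1$. (Hence in fact $\nu_f(f(y))=\nu_f(y)\deg_y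 f$.) 3. The orbifold is parabolic, i.e. $2-\sum_{x\in P_f}\bigl(1-\frac1{\nu_f(x)}\bigr)=0$ with $\frac1\infty=0$, and its weights $(\nu_f(x))_{x\in P_f}$ are, up to order, one of $$(\infty,\infty),\quad (2,2,\infty),\quad (2,2,2,2),\quad (3,3,3),\quad (2,4,4),\quad (2,3,6).$$ 4. For every $x\in\mathbb{P}^1$, either $\mathrm{ord}_x(q)=-k$ and $\nu_f(x)=\infty$, or there is $n\in\{1,2,3,4,6\}$ with $\mathrm{ord}_x(q)=-\left(1-\frac1n\right)k$ and $\nu_f(x)=n$. In particular $q$ has no zeros, and its poles have order $k$ or $\left(1-\frac1n\right)k$ with $n\in\{2,3,4,6\}$. -/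

import Mathlib

open Filter Polynomial
open scoped OnePoint

noncomputable section

namespace ParallelTensor

/-! ### Rational maps of the Riemann sphere

The Riemann sphere is `OnePoint ℂ`, with the coordinate `z` on `ℂ` and the coordinate `w = 1 / z`
around `∞`.  A rational map is a rational function `f = p / q` with `p = f.num` and `q = f.denom`
coprime. -/

/-- The degree of a rational map `p / q` (in lowest terms): `max (deg p) (deg q)`. -/
def ratDegree (f : RatFunc ℂ) : ℕ := max f.num.natDegree f.denom.natDegree

/-- The rational function `p / q` as a function of the coordinate `z`
(only meaningful away from the finitely many zeros of `q`). -/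
def affineMap (f : RatFunc ℂ) (z : ℂ) : ℂ := f.num.eval z / f.denom.eval z

/-- The self-map of the Riemann sphere given by `f = p / q`.  In homogeneous coordinates,
`z ↦ [p(z) : q(z)]` for `z ∈ ℂ`, and `∞ ↦ [p_d : q_d]`, the coefficients of degree `d = deg f`. -/
def sphereMap (f : RatFunc ℂ) : OnePoint ℂ → OnePoint ℂ
  | (z : ℂ) => if f.denom.eval z = 0 then ∞ else ((f.num.eval z / f.denom.eval z : ℂ) : OnePoint ℂ)
  | ∞ => if f.denom.coeff (ratDegree f) = 0 then ∞
      else ((f.num.coeff (ratDegree f) / f.denom.coeff (ratDegree f) : ℂ) : OnePoint ℂ)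

/-- The polynomial whose zeros on the sphere, when it is regarded as a form of degree `deg f`, are
the solutions of `f = x` with multiplicity: `p - x q` for `x ∈ ℂ`, and `q` for `x = ∞`. -/
def fiberPoly (f : RatFunc ℂ) : OnePoint ℂ → ℂ[X]
  | (x : ℂ) => f.num - C x * f.denom
  | ∞ => f.denom

/-- The local degree `deg_y f`: the multiplicity of `y` as a solution of `f = f(y)`
(`f` has the form `s ↦ s ^ n` in suitable coordinates at `y` and `f(y)`, with `n = deg_y f`).
A polynomial `r` regarded as a form of degree `d` vanishes at `∞` to the order `d - deg r`. -/
def localDegree (f : RatFunc ℂ) : OnePoint ℂ → ℕ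
  | (z : ℂ) => (fiberPoly f (sphereMap f z)).rootMultiplicity z
  | ∞ => ratDegree f - (fiberPoly f (sphereMap f ∞)).natDegree

/-- The ramification points of `f`. -/
def ramification (f : RatFunc ℂ) : Set (OnePoint ℂ) := {y | 1 < localDegree f y}

/-- The post-critical set: the union of the `f^n (Ram_f)` for `n > 0`. -/
def postcritical (f : RatFunc ℂ) : Set (OnePoint ℂ) :=
  ⋃ n : ℕ, ⋃ _ : 0 < n, (sphereMap f)^[n] '' ramification f

/-! ### Meromorphic differentials of order `k` on the Riemann sphere -/

/-- A meromorphic section `q = h(z) dz^k` of the `k`-th power of the cotangent bundle of the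
Riemann sphere.  Since `dz = -w⁻² dw`, it reads `h(1/w) (-w⁻²)^k dw^k` around `∞`.  Mathlib's
meromorphic functions may have arbitrary values on a discrete set, so two of these represent the
same section if their coefficients agree off a discrete set. -/
structure MeroDifferential (k : ℕ) where
  /-- the coefficient `h` in the coordinate `z` -/
  coeff : ℂ → ℂ
  meromorphic : ∀ z : ℂ, MeromorphicAt coeff z
  meromorphic_infty : MeromorphicAt (fun w : ℂ => coeff w⁻¹ * (-(w ^ 2)⁻¹) ^ k) 0

namespace MeroDifferential

variable {k : ℕ}

/-- The coefficient of `q` in the coordinate `w = 1 / z` around `∞`. -/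
def coeffInfty (q : MeroDifferential k) (w : ℂ) : ℂ := q.coeff w⁻¹ * (-(w ^ 2)⁻¹) ^ k

/-- The order `ord_x q` (negative at poles, and `⊤` only if `q` vanishes identically). -/
def ord (q : MeroDifferential k) : OnePoint ℂ → WithTop ℤ
  | (z : ℂ) => meromorphicOrderAt q.coeff z
  | ∞ => meromorphicOrderAt q.coeffInfty 0

/-- `q` is not the zero section. -/
def IsNonzero (q : MeroDifferential k) : Prop := ¬ q.coeff =ᶠ[codiscrete ℂ] 0

/-- The coefficient of the pull-back: `f^* q = h(f(z)) f'(z)^k dz^k`. -/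
def pullbackCoeff (f : RatFunc ℂ) (q : MeroDifferential k) (z : ℂ) : ℂ :=
  q.coeff (affineMap f z) * deriv (affineMap f) z ^ k

/-- `f^* q = lam q` as meromorphic sections. -/
def IsParallel (f : RatFunc ℂ) (q : MeroDifferential k) (lam : ℂ) : Prop :=
  pullbackCoeff f q =ᶠ[codiscrete ℂ] fun z => lam * q.coeff z

end MeroDifferential

/-! ### Orbifold structures on the Riemann sphere

An orbifold structure is a weight function with values in `{1, 2, 3, …, ∞}`.  In `ℕ∞`, every nonzero
weight divides `⊤`, and `⊤` divides no nonzero weight but `⊤`. -/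

/-- `ν` is positive and is `1` outside the post-critical set of `f`. -/
def IsWeight (f : RatFunc ℂ) (ν : OnePoint ℂ → ℕ∞) : Prop :=
  (∀ x, 1 ≤ ν x) ∧ ∀ x, x ∉ postcritical f → ν x = 1

/-- `f` preserves the orbifold with the weights `ν`, that is, lifts to a map of orbifolds:
`ν (f y)` divides `ν y * deg_y f`. -/
def PreservesOrbifold (f : RatFunc ℂ) (ν : OnePoint ℂ → ℕ∞) : Prop :=
  IsWeight f ν ∧ ∀ y, ν (sphereMap f y) ∣ ν y * (localDegree f y : ℕ∞)

/-- The weights among which the canonical orbifold of `f` has the smallest one: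
`ν (f y)` is a multiple of `ν y * deg_y f`. -/
def IsCriticalWeight (f : RatFunc ℂ) (ν : OnePoint ℂ → ℕ∞) : Prop :=
  IsWeight f ν ∧ ∀ y, ν y * (localDegree f y : ℕ∞) ∣ ν (sphereMap f y)

/-- `ν = ν_f`, the (pointwise) smallest weight function `ν` that is `1` outside the post-critical
set and such that `ν (f y)` is always a multiple of `ν y * deg_y f`. -/
def IsCanonicalWeight (f : RatFunc ℂ) (ν : OnePoint ℂ → ℕ∞) : Prop :=
  IsLeast {μ | IsCriticalWeight f μ} ν

/-- `1 - 1 / n` for a weight `n`, with `1 - 1 / ∞ = 1`. -/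
def weightDefect (n : ℕ∞) : ℚ := if n = ⊤ then 1 else 1 - 1 / (n.toNat : ℚ)

/-- The Euler characteristic of an orbifold structure on the sphere whose points of weight
different from `1` lie in the finite set `P`. -/
def eulerChar (P : Finset (OnePoint ℂ)) (ν : OnePoint ℂ → ℕ∞) : ℚ :=
  2 - ∑ x ∈ P, weightDefect (ν x)

/-- The six strings of weights. -/
def parabolicTypes : Set (Multiset ℕ∞) :=
  {{⊤, ⊤}, {2, 2, ⊤}, {2, 2, 2, 2}, {3, 3, 3}, {2, 4, 4}, {2, 3, 6}}

end ParallelTensor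

end

noncomputable section

namespace ParallelTensor

/-! ### Weights of Euler characteristic zero -/

/-! Put `a = ord q + k`. In suitable coordinates `f` is `s ↦ s ^ e` with `e = deg_y f`, and `f^* q =
lam q` then says `a y = e * a (f y)`. Moreover `a = k` off a finite set. Everything about weights
follows from these two facts (`IsScaledOrder`).

A finite set containing its preimage consists of points with a single preimage, which is totally
ramified, so passing to the preimage at least doubles `|a|`; hence `a = 0` on the set
(`IsScaledOrder.eq_zero_of_mem`). If `a x ≠ 0`, the backward orbit of `x` must therefore meet `{a =
k}`, and multiplying local degrees along the way gives `n * a x = k` with `n ≥ 1`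
(`IsScaledOrder.exists_mul_eq`). So `ν = k / a`, with value `∞` at the zeros of `a`, is a weight
satisfying `ν (f y) = ν y * deg_y f`. It differs from `1` exactly on the post-critical set, and any
other admissible weight grows at least as fast along orbits.

The divisor of `q` has degree `-2k` (`MeroDifferential.sum_intOrd`, from Liouville's theorem), so
the defects `1 - 1 / ν = (k - a) / k` add up to `2`. An elementary enumeration then yields the six
types. -/

lemma weightDefect_top : weightDefect ⊤ = 1 := by simp [weightDefect]

lemma weightDefect_natCast (n : ℕ) : weightDefect (n : ℕ∞) = 1 - 1 / (n : ℚ) := by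
  simp [weightDefect]

lemma weightDefect_lt_one {n : ℕ} (hn : 1 ≤ n) : weightDefect (n : ℕ∞) < 1 := by
  rw [weightDefect_natCast]
  have : (0 : ℚ) < n := by exact_mod_cast hn
  linarith [one_div_pos.2 this]

lemma weightDefect_le_one {n : ℕ∞} (hn : 1 ≤ n) : weightDefect n ≤ 1 := by
  induction n with
  | top => simp [weightDefect_top]
  | coe n => exact (weightDefect_lt_one (by exact_mod_cast hn)).le

lemma weightDefect_mono {m n : ℕ∞} (hm : 1 ≤ m) (h : m ≤ n) : weightDefect m ≤ weightDefect n := by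
  induction n with
  | top => rw [weightDefect_top]; exact weightDefect_le_one hm
  | coe n =>
    lift m to ℕ using ne_top_of_le_ne_top (ENat.natCast_ne_top n) h
    rw [weightDefect_natCast, weightDefect_natCast]
    have h1 : (0 : ℚ) < m := by exact_mod_cast hm
    have h2 : (m : ℚ) ≤ n := by exact_mod_cast h
    linarith [one_div_le_one_div_of_le h1 h2]

lemma weightDefect_injOn {m n : ℕ∞} (hm : 1 ≤ m) (hn : 1 ≤ n)
    (h : weightDefect m = weightDefect n) : m = n := by
  induction m with
  | top =>
    induction n with
    | top => rfl
    | coe n =>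
      have := weightDefect_lt_one (n := n) (by exact_mod_cast hn)
      rw [← h, weightDefect_top] at this
      exact absurd this (lt_irrefl _)
  | coe m =>
    induction n with
    | top =>
      have := weightDefect_lt_one (n := m) (by exact_mod_cast hm)
      rw [h, weightDefect_top] at this
      exact absurd this (lt_irrefl _)
    | coe n =>
      rw [weightDefect_natCast, weightDefect_natCast] at h
      have : (m : ℚ) = n := by simpa using h
      exact_mod_cast this

lemma weightDefect_two : weightDefect 2 = 1 / 2 := by
  have := weightDefect_natCast 2
  norm_num at this
  simpa using this

lemma half_le_weightDefect {n : ℕ∞} (hn : 2 ≤ n) : 1 / 2 ≤ weightDefect n := by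
  rw [← weightDefect_two]
  exact weightDefect_mono (by norm_num) hn

lemma le_of_weightDefect_le {x : ℕ∞} {n : ℕ} (hn : 1 ≤ n) (h : weightDefect x ≤ weightDefect n) :
    x ≤ n := by
  by_contra! hlt
  have hn' : (1 : ℕ∞) ≤ n := by exact_mod_cast hn
  have h1 := weightDefect_mono hn' hlt.le
  exact hlt.ne' (weightDefect_injOn (hn'.trans hlt.le) hn' (le_antisymm h h1))

lemma eq_of_weightDefect_eq {x : ℕ∞} {n : ℕ} (hx : 2 ≤ x) (hn : 1 ≤ n)
    (h : weightDefect x = 1 - 1 / (n : ℚ)) : x = n :=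
  weightDefect_injOn (le_trans (by norm_num) hx) (by exact_mod_cast hn)
    (h.trans (weightDefect_natCast n).symm)

lemma triple_mem_parabolicTypes_of_le {x y z : ℕ∞} (hx : 2 ≤ x) (hxy : x ≤ y) (hyz : y ≤ z)
    (h : weightDefect x + weightDefect y + weightDefect z = 2) :
    ({x, y, z} : Multiset ℕ∞) ∈ parabolicTypes := by
  have one_le : (1 : ℕ∞) ≤ 2 := by norm_num
  have hy := hx.trans hxy
  have hz := hy.trans hyz
  have h1 := weightDefect_mono (one_le.trans hx) hxy
  have h2 := weightDefect_mono (one_le.trans hy) hyz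
  have h3 := weightDefect_le_one (one_le.trans hz)
  -- The smallest of three defects with sum 2 is at most 2/3.
  have hx3 : x ≤ (3 : ℕ) := by
    refine le_of_weightDefect_le (by norm_num) ?_
    rw [weightDefect_natCast]
    norm_num
    linarith
  lift x to ℕ using ne_top_of_le_ne_top (ENat.natCast_ne_top 3) hx3
  have hx3' : x ≤ 3 := by exact_mod_cast hx3
  have hx2' : 2 ≤ x := by exact_mod_cast hx
  -- The first defect is at least 1/2, so the other two add up to at most 3/2 and the smaller of
  -- them is at most 3/4.
  have hy4 : y ≤ (4 : ℕ) := by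
    refine le_of_weightDefect_le (by norm_num) ?_
    have := half_le_weightDefect hx
    rw [weightDefect_natCast 4]
    norm_num
    linarith
  lift y to ℕ using ne_top_of_le_ne_top (ENat.natCast_ne_top 4) hy4
  have hy4' : y ≤ 4 := by exact_mod_cast hy4
  have hxy' : x ≤ y := by exact_mod_cast hxy
  rw [weightDefect_natCast, weightDefect_natCast] at h
  unfold parabolicTypes
  have key (n : ℕ) (hn : 1 ≤ n) (hd : weightDefect z = 1 - 1 / (n : ℚ)) : z = n :=
    eq_of_weightDefect_eq hz hn hd
  rw [weightDefect_natCast] at h2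
  interval_cases x <;> interval_cases y
  · have : z = ⊤ := weightDefect_injOn (one_le.trans hz) le_top (by
      rw [weightDefect_top]; norm_num at h; linarith)
    simp [this]
  · have := key 6 (by norm_num) (by norm_num at h ⊢; linarith)
    simp [this]
  · have := key 4 (by norm_num) (by norm_num at h ⊢; linarith)
    simp [this]
  · have := key 3 (by norm_num) (by norm_num at h ⊢; linarith)
    simp [this]
  -- The case (3, 4): the third defect would be 7/12, below that of 4.
  · norm_num at h h2
    linarith

lemma triple_mem_parabolicTypes {x y z : ℕ∞} (hx : 2 ≤ x) (hy : 2 ≤ y) (hz : 2 ≤ z)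
    (h : weightDefect x + weightDefect y + weightDefect z = 2) :
    ({x, y, z} : Multiset ℕ∞) ∈ parabolicTypes := by
  have swap₁ (a b c : ℕ∞) : ({a, b, c} : Multiset ℕ∞) = {b, a, c} := Multiset.cons_swap a b {c}
  have swap₂ (a b c : ℕ∞) : ({a, b, c} : Multiset ℕ∞) = {a, c, b} :=
    congrArg (a ::ₘ ·) (Multiset.cons_swap b c 0)
  rcases le_total x y with h1 | h1 <;> rcases le_total y z with h2 | h2 <;>
    rcases le_total x z with h3 | h3
  · exact triple_mem_parabolicTypes_of_le hx h1 h2 h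
  · exact triple_mem_parabolicTypes_of_le hx h1 h2 h
  · rw [swap₂]; exact triple_mem_parabolicTypes_of_le hx h3 h2 (by linarith)
  · rw [swap₂, swap₁]; exact triple_mem_parabolicTypes_of_le hz h3 h1 (by linarith)
  · rw [swap₁]; exact triple_mem_parabolicTypes_of_le hy h1 h3 (by linarith)
  · rw [swap₁, swap₂]; exact triple_mem_parabolicTypes_of_le hy h2 h3 (by linarith)
  · rw [swap₁, swap₂, swap₁]; exact triple_mem_parabolicTypes_of_le hz h2 h1 (by linarith)
  · rw [swap₁, swap₂, swap₁]; exact triple_mem_parabolicTypes_of_le hz h2 h1 (by linarith)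

/-- The weights at least `2` of an orbifold sphere with Euler characteristic `0`. -/
theorem mem_parabolicTypes_of_sum_weightDefect {s : Multiset ℕ∞} (hs : ∀ n ∈ s, 2 ≤ n)
    (hsum : (s.map weightDefect).sum = 2) : s ∈ parabolicTypes := by
  have one_le {n : ℕ∞} (hn : 2 ≤ n) : 1 ≤ n := le_trans (by norm_num) hn
  -- Each defect lies in [1/2, 1], so there are two to four weights. Both extremes force equality:
  -- all weights are infinite, or all are 2.
  have hlow : s.card • (1 / 2 : ℚ) ≤ 2 := by
    refine le_of_le_of_eq ?_ hsum
    rw [← Multiset.card_map weightDefect s]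
    refine Multiset.card_nsmul_le_sum fun x hx => ?_
    obtain ⟨n, hn, rfl⟩ := Multiset.mem_map.1 hx
    exact half_le_weightDefect (hs n hn)
  have hup : 2 ≤ s.card • (1 : ℚ) := by
    refine le_of_eq_of_le hsum.symm ?_
    rw [← Multiset.card_map weightDefect s]
    refine Multiset.sum_le_card_nsmul _ _ fun x hx => ?_
    obtain ⟨n, hn, rfl⟩ := Multiset.mem_map.1 hx
    exact weightDefect_le_one (one_le (hs n hn))
  rw [nsmul_eq_mul] at hlow hup
  have h4 : s.card ≤ 4 := by
    have : (s.card : ℚ) ≤ 4 := by linarith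
    exact_mod_cast this
  have h2 : 2 ≤ s.card := by
    have : (2 : ℚ) ≤ s.card := by linarith
    exact_mod_cast this
  interval_cases hc : s.card
  · obtain ⟨x, y, rfl⟩ := Multiset.card_eq_two.1 hc
    simp only [Multiset.insert_eq_cons, Multiset.mem_cons, Multiset.mem_singleton,
      forall_eq_or_imp, forall_eq, Multiset.map_cons, Multiset.map_singleton, Multiset.sum_cons,
      Multiset.sum_singleton] at hs hsum
    have hx := weightDefect_le_one (one_le hs.1)
    have hy := weightDefect_le_one (one_le hs.2)
    rw [weightDefect_injOn (one_le hs.1) le_top (by rw [weightDefect_top]; linarith),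
      weightDefect_injOn (one_le hs.2) le_top (by rw [weightDefect_top]; linarith)]
    simp [parabolicTypes]
  · obtain ⟨x, y, z, rfl⟩ := Multiset.card_eq_three.1 hc
    simp only [Multiset.insert_eq_cons, Multiset.mem_cons, Multiset.mem_singleton,
      forall_eq_or_imp, forall_eq, Multiset.map_cons, Multiset.map_singleton, Multiset.sum_cons,
      Multiset.sum_singleton] at hs hsum
    exact triple_mem_parabolicTypes hs.1 hs.2.1 hs.2.2 (by linarith)
  · obtain ⟨x, t, rfl⟩ := Multiset.exists_mem_of_ne_zero (s := s) (by rintro rfl; simp at hc) |>.imp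
      fun x hx => Multiset.exists_cons_of_mem hx
    have ht : t.card = 3 := by simpa using hc
    obtain ⟨y, z, w, rfl⟩ := Multiset.card_eq_three.1 ht
    simp only [Multiset.insert_eq_cons, Multiset.mem_cons, Multiset.mem_singleton,
      forall_eq_or_imp, forall_eq, Multiset.map_cons, Multiset.map_singleton, Multiset.sum_cons,
      Multiset.sum_singleton] at hs hsum
    obtain ⟨hx, hy, hz, hw⟩ := hs
    have h1 := half_le_weightDefect hx
    have h2 := half_le_weightDefect hy
    have h3 := half_le_weightDefect hz
    have h4 := half_le_weightDefect hw
    have eq_two {n : ℕ∞} (hn : 2 ≤ n) (h : weightDefect n = 1 / 2) : n = 2 :=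
      weightDefect_injOn (one_le hn) (by norm_num) (h.trans weightDefect_two.symm)
    rw [eq_two hx (by linarith), eq_two hy (by linarith), eq_two hz (by linarith),
      eq_two hw (by linarith)]
    simp [parabolicTypes]

lemma mem_of_mem_parabolicTypes {s : Multiset ℕ∞} (hs : s ∈ parabolicTypes) {n : ℕ}
    (hn : (n : ℕ∞) ∈ s) : n ∈ ({1, 2, 3, 4, 6} : Finset ℕ) := by
  simp only [parabolicTypes, Set.mem_insert_iff, Set.mem_singleton_iff] at hs
  have e2 : (n : ℕ∞) = 2 → n = 2 := fun h => by exact_mod_cast h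
  have e3 : (n : ℕ∞) = 3 → n = 3 := fun h => by exact_mod_cast h
  have e4 : (n : ℕ∞) = 4 → n = 4 := fun h => by exact_mod_cast h
  have e6 : (n : ℕ∞) = 6 → n = 6 := fun h => by exact_mod_cast h
  have et : (n : ℕ∞) ≠ ⊤ := ENat.natCast_ne_top n
  simp only [Finset.mem_insert, Finset.mem_singleton]
  rcases hs with rfl | rfl | rfl | rfl | rfl | rfl <;>
  simp only [Multiset.insert_eq_cons, Multiset.mem_cons, Multiset.mem_singleton] at hn <;> tauto

/-! ### Finite backward invariant sets -/

/-- A finite set containing its preimage under a surjective map is permuted by the map, and each of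
its points has a single preimage. -/
lemma exists_unique_preimage_of_finite {X : Type*} {F : X → X} (hF : F.Surjective) {S : Set X}
    (hS : S.Finite) (hback : ∀ y, F y ∈ S → y ∈ S) {x : X} (hx : x ∈ S) :
    ∃ y ∈ S, F y = x ∧ ∀ z, F z = x → z = y := by
  -- A right inverse of `F` maps `S` injectively into itself, hence onto it. Every preimage of a
  -- point of `S` is thus a value of `s`, and applying `F` identifies it.
  set s := Function.surjInv hF with hs
  have hFs (x : X) : F (s x) = x := Function.surjInv_eq hF x
  have hsS : Set.MapsTo s S S := fun x hx => hback _ (by rwa [hFs])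
  have hinj : Set.InjOn s S := (Function.injective_surjInv hF).injOn
  have hsurj : Set.SurjOn s S S := by
    have := Set.eq_of_subset_of_ncard_le hsS.image_subset hinj.ncard_image.ge hS
    rw [Set.SurjOn, this]
  refine ⟨s x, hsS hx, hFs x, fun z hz => ?_⟩
  obtain ⟨w, -, rfl⟩ := hsurj (hback z (by rwa [hz]))
  rw [← hz, hFs]

/-! ### Scaled orders: the dynamics of `ord q + k` -/

/-- The data of a parallel tensor in terms of `a = ord q + k`: the map `F` with local degrees `e`
multiplies `a` by the local degree, and `a` is almost everywhere equal to `K = k`. -/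
structure IsScaledOrder {X : Type*} (F : X → X) (e : X → ℕ) (a : X → ℤ) (K : ℕ) : Prop where
  surjective : F.Surjective
  one_le : ∀ y, 1 ≤ e y
  one_lt : ∀ y, (∀ z, F z = F y → z = y) → 1 < e y
  scaled : ∀ y, a y = e y * a (F y)
  finite : {x | a x ≠ K}.Finite
  pos : 0 < K

namespace IsScaledOrder

variable {X : Type*} {F : X → X} {e : X → ℕ} {a : X → ℤ} {K : ℕ}

lemma ne_zero (h : IsScaledOrder F e a K) (y : X) : e y ≠ 0 :=
  Nat.one_le_iff_ne_zero.1 (h.one_le y)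

lemma exists_preimage (h : IsScaledOrder F e a K) {S : Set X} (hS : S.Finite)
    (hback : ∀ y, F y ∈ S → y ∈ S) {x : X} (hx : x ∈ S) : ∃ y ∈ S, F y = x ∧ 2 ≤ e y := by
  obtain ⟨y, hy, rfl, hu⟩ := exists_unique_preimage_of_finite h.surjective hS hback hx
  exact ⟨y, hy, rfl, h.one_lt y hu⟩

/-- At a point where `|a|` is maximal on `S`, the preimage has at least twice that value and still
lies in `S`, so the maximum is 0. -/
lemma eq_zero_of_mem (h : IsScaledOrder F e a K) {S : Set X} (hS : S.Finite)
    (hback : ∀ y, F y ∈ S → y ∈ S) {x : X} (hx : x ∈ S) : a x = 0 := by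
  obtain ⟨x₀, hx₀, hmax⟩ := Set.exists_max_image S (fun x => |a x|) hS ⟨x, hx⟩
  obtain ⟨y, hy, rfl, he⟩ := h.exists_preimage hS hback hx₀
  have h1 := hmax y hy
  have h2 := hmax x hx
  simp only [h.scaled y, abs_mul, Nat.abs_cast] at h1
  have h3 : (2 : ℤ) ≤ e y := by exact_mod_cast he
  have h4 := abs_nonneg (a (F y))
  have h5 := mul_le_mul_of_nonneg_right h3 h4
  have : |a x| ≤ 0 := by linarith
  exact abs_nonpos_iff.1 this

lemma eq_zero_iff (h : IsScaledOrder F e a K) (y : X) : a (F y) = 0 ↔ a y = 0 := by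
  rw [h.scaled y]
  simp [h.ne_zero y]

lemma finite_zeros (h : IsScaledOrder F e a K) : {x | a x = 0}.Finite :=
  h.finite.subset fun y hy => by
    have hy' : a y = 0 := hy
    have : (K : ℤ) ≠ 0 := by exact_mod_cast h.pos.ne'
    show a y ≠ K
    rw [hy']
    exact this.symm

/-- Where `a` does not vanish, the backward orbit contains points with `a = K`. -/
lemma exists_iterate_eq (h : IsScaledOrder F e a K) {x : X} (hx : a x ≠ 0) :
    ∃ m y, F^[m] y = x ∧ a y = K := by
  by_contra! hcon
  -- The backward orbit of `x` contains its own preimage; if it avoided `{a = K}` it would be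
  -- finite.
  refine hx (h.eq_zero_of_mem (S := {y | ∃ m, F^[m] y = x}) ?_ ?_ ⟨0, rfl⟩)
  · exact h.finite.subset fun y ⟨m, hm⟩ => hcon m y hm
  · rintro y ⟨m, hm⟩
    exact ⟨m + 1, hm⟩

/-- The factor is the product of the local degrees along the orbit, that is, the local degree of the
iterate. -/
lemma exists_mul_iterate (h : IsScaledOrder F e a K) (y : X) (m : ℕ) :
    ∃ n : ℕ, 1 ≤ n ∧ a y = n * a (F^[m] y) := by
  induction m generalizing y with
  | zero => exact ⟨1, le_rfl, by simp⟩
  | succ m ih =>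
    obtain ⟨n, hn, h1⟩ := ih (F y)
    refine ⟨e y * n, Nat.mul_pos (h.one_le y) hn, ?_⟩
    rw [h.scaled y, h1, Function.iterate_succ_apply]
    push_cast
    ring

/-- This integrality excludes negative values of `a` and values above `K`; in terms of `q`, poles of
order above `k` and zeros. -/
lemma exists_mul_eq (h : IsScaledOrder F e a K) {x : X} (hx : a x ≠ 0) :
    ∃ n : ℕ, 1 ≤ n ∧ n * a x = K := by
  obtain ⟨m, y, rfl, hy⟩ := h.exists_iterate_eq hx
  obtain ⟨n, hn, h1⟩ := h.exists_mul_iterate y m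
  exact ⟨n, hn, by rw [← h1, hy]⟩

end IsScaledOrder

/-! ### The canonical weight as a quotient -/

/-- The weight `K / a`, which is `∞` where `a` vanishes. -/
def quotientWeight {X : Type*} (a : X → ℤ) (K : ℕ) (x : X) : ℕ∞ :=
  if a x = 0 then ⊤ else (((K : ℤ) / a x).toNat : ℕ)

lemma quotientWeight_of_eq_zero {X : Type*} {a : X → ℤ} {K : ℕ} {x : X} (hx : a x = 0) :
    quotientWeight a K x = ⊤ := if_pos hx

lemma quotientWeight_of_mul_eq {X : Type*} {a : X → ℤ} {K n : ℕ} {x : X} (hx : a x ≠ 0)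
    (hn : n * a x = K) : quotientWeight a K x = n := by
  rw [quotientWeight, if_neg hx, ← hn, Int.mul_ediv_cancel _ hx, Int.toNat_natCast]

namespace IsScaledOrder

variable {X : Type*} {F : X → X} {e : X → ℕ} {a : X → ℤ} {K : ℕ}

lemma one_le_quotientWeight (h : IsScaledOrder F e a K) (x : X) : 1 ≤ quotientWeight a K x := by
  by_cases hx : a x = 0
  · simp [quotientWeight_of_eq_zero hx]
  · obtain ⟨n, hn, h1⟩ := h.exists_mul_eq hx
    rw [quotientWeight_of_mul_eq hx h1]
    exact_mod_cast hn

lemma quotientWeight_eq_one_iff (h : IsScaledOrder F e a K) (x : X) :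
    quotientWeight a K x = 1 ↔ a x = K := by
  by_cases hx : a x = 0
  · have := h.pos
    rw [quotientWeight_of_eq_zero hx, hx]
    simp only [ENat.top_ne_one, false_iff]
    omega
  · obtain ⟨n, hn, h1⟩ := h.exists_mul_eq hx
    rw [quotientWeight_of_mul_eq hx h1]
    constructor
    · intro hn1
      have : n = 1 := by exact_mod_cast hn1
      rw [← h1, this]
      simp
    · intro hxK
      rw [← h1] at hxK
      have := mul_right_cancel₀ hx ((one_mul (a x)).trans hxK)
      exact_mod_cast this.symm

/-- Dividing `K` by `a y = e y * a (F y)`. The equality yields both divisibilities, for critical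
weights and for preserving the orbifold. -/
lemma quotientWeight_map (h : IsScaledOrder F e a K) (y : X) :
    quotientWeight a K (F y) = quotientWeight a K y * (e y : ℕ∞) := by
  by_cases hy : a y = 0
  · rw [quotientWeight_of_eq_zero hy, quotientWeight_of_eq_zero ((h.eq_zero_iff y).2 hy),
      ENat.top_mul]
    exact_mod_cast h.ne_zero y
  · obtain ⟨n, hn, h1⟩ := h.exists_mul_eq hy
    rw [quotientWeight_of_mul_eq hy h1, quotientWeight_of_mul_eq (n := n * e y)]
    · push_cast
      rfl
    · rwa [Ne, h.eq_zero_iff]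
    · rw [← h1, h.scaled y]
      push_cast
      ring

/-- The points with `a ≠ K` are the post-critical ones. -/
lemma mem_postcritical_iff (h : IsScaledOrder F e a K) (x : X) :
    x ∈ (⋃ n : ℕ, ⋃ _ : 0 < n, F^[n] '' {y | 1 < e y}) ↔ a x ≠ K := by
  rw [Ne, ← h.quotientWeight_eq_one_iff]
  set ν := quotientWeight a K with hν
  simp only [Set.mem_iUnion, Set.mem_image, Set.mem_ofPred_eq, exists_prop]
  -- A weight other than 1 arises after a ramified point and persists forward.
  have map_ne (y : X) (hy : ν y ≠ 1 ∨ 1 < e y) : ν (F y) ≠ 1 := by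
    have h1 : 1 ≤ ν y := h.one_le_quotientWeight y
    have h2 := h.one_le y
    rw [hν, h.quotientWeight_map, ← hν]
    rcases eq_or_ne (ν y) ⊤ with ht | ht
    · rw [ht, ENat.top_mul (by exact_mod_cast h.ne_zero y)]
      exact ENat.top_ne_one
    · lift ν y to ℕ using ht with n
      norm_cast at h1 hy ⊢
      intro h3
      have := Nat.eq_one_of_mul_eq_one_right h3
      have := Nat.eq_one_of_mul_eq_one_left h3
      omega
  constructor
  · rintro ⟨n, hn, y, hy, rfl⟩
    induction n, hn using Nat.le_induction with
    | base => exact map_ne y (Or.inr hy)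
    | succ n _ ih =>
      rw [Function.iterate_succ_apply']
      exact map_ne _ (Or.inl ih)
  · intro hx
    by_contra! hcon
    rcases eq_or_ne (a x) 0 with h0 | h0
    · obtain ⟨y, -, hyx, hy⟩ := h.exists_preimage h.finite_zeros
        (fun y hy => (h.eq_zero_iff y).1 hy) h0
      exact hcon 1 one_pos y hy hyx
    · obtain ⟨m, y, rfl, hy⟩ := h.exists_iterate_eq h0
      -- Without ramification on the way from `y` to `x`, the weight keeps its initial value 1.
      have key (i : ℕ) (hi : i ≤ m) : ν (F^[i] y) = 1 := by
        induction i with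
        | zero => exact (h.quotientWeight_eq_one_iff y).2 hy
        | succ i ih =>
          have he : ¬ 1 < e (F^[i] y) := fun hlt => by
            refine hcon (m - i) (by omega) _ hlt ?_
            rw [← Function.iterate_add_apply]
            congr 2
            omega
          have he1 : e (F^[i] y) = 1 := le_antisymm (not_lt.1 he) (h.one_le _)
          rw [Function.iterate_succ_apply', hν, h.quotientWeight_map, ← hν, ih (by omega), he1]
          simp
      exact hx (key m le_rfl)

/-- `K / a` is the smallest weight. -/
lemma quotientWeight_le (h : IsScaledOrder F e a K) {μ : X → ℕ∞} (hμ : ∀ x, 1 ≤ μ x)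
    (hdvd : ∀ y, μ y * (e y : ℕ∞) ∣ μ (F y)) (x : X) : quotientWeight a K x ≤ μ x := by
  have hle (y : X) : μ y * (e y : ℕ∞) ≤ μ (F y) := by
    obtain ⟨c, hc⟩ := hdvd y
    rw [hc]
    refine le_mul_of_one_le_right' (Order.one_le_iff_ne_zero.2 ?_)
    rintro rfl
    have := hμ (F y)
    simp [hc] at this
  rcases eq_or_ne (a x) 0 with h0 | h0
  · rw [quotientWeight_of_eq_zero h0, top_le_iff]
    -- Where `μ` is smallest among the zeros of `a`, the preimage `y` is again a zero and `2 * μ y ≤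
    -- μ (F y) ≤ μ y`, which is impossible for a finite value.
    obtain ⟨x₀, hx₀, hmin⟩ := Set.exists_min_image {x | a x = 0} μ h.finite_zeros ⟨x, h0⟩
    obtain ⟨y, hy, rfl, he⟩ := h.exists_preimage h.finite_zeros
      (fun y hy => (h.eq_zero_iff y).1 hy) hx₀
    have htop : μ (F y) = ⊤ := by
      by_contra hne
      have h1 := (hle y).trans (hmin y hy)
      have h2 := hμ y
      have h3 : μ y ≠ ⊤ := fun ht => by
        rw [ht, ENat.top_mul (by exact_mod_cast h.ne_zero y)] at h1
        have := hle y
        rw [ht, ENat.top_mul (by exact_mod_cast h.ne_zero y), top_le_iff] at this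
        exact hne this
      lift μ y to ℕ using h3 with n
      norm_cast at h1 h2
      nlinarith
    have := hmin x h0
    rwa [htop, top_le_iff] at this
  -- Start where `K / a` is 1: it grows by exactly the local degree at each step, and `μ` by at
  -- least that factor.
  · obtain ⟨m, y, rfl, hy⟩ := h.exists_iterate_eq h0
    clear h0
    induction m with
    | zero =>
      rw [Function.iterate_zero_apply, (h.quotientWeight_eq_one_iff y).2 hy]
      exact hμ _
    | succ m ih =>
      rw [Function.iterate_succ_apply', h.quotientWeight_map]
      exact (mul_le_mul_left ih _).trans (hle _)

/-- Turns the degree of the divisor of `q` into the Euler characteristic, since `K - a` is `-ord q`.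
-/
lemma weightDefect_quotientWeight (h : IsScaledOrder F e a K) (x : X) :
    weightDefect (quotientWeight a K x) = ((K : ℚ) - a x) / K := by
  have hK : (K : ℚ) ≠ 0 := by exact_mod_cast h.pos.ne'
  rcases eq_or_ne (a x) 0 with h0 | h0
  · rw [quotientWeight_of_eq_zero h0, weightDefect_top, h0]
    field_simp
    simp
  · obtain ⟨n, hn, h1⟩ := h.exists_mul_eq h0
    rw [quotientWeight_of_mul_eq h0 h1, weightDefect_natCast]
    have h2 : (n : ℚ) * a x = K := by exact_mod_cast h1
    have h3 : (n : ℚ) ≠ 0 := by exact_mod_cast (show n ≠ 0 by omega)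
    rw [sub_div, div_self hK]
    congr 1
    rw [div_eq_div_iff h3 hK]
    linarith

end IsScaledOrder

/-- The part of the theorem that depends only on the orders of `q` and the local degrees. -/
theorem exists_weight_of_isScaledOrder {f : RatFunc ℂ} {a : OnePoint ℂ → ℤ} {K : ℕ}
    (h : IsScaledOrder (sphereMap f) (localDegree f) a K)
    (hdeg : ∑ x ∈ h.finite.toFinset, ((K : ℤ) - a x) = 2 * K) :
    ∃ (ν : OnePoint ℂ → ℕ∞) (P : Finset (OnePoint ℂ)),
      (P : Set (OnePoint ℂ)) = postcritical f ∧
      IsCanonicalWeight f ν ∧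
      PreservesOrbifold f ν ∧
      P.val.map ν ∈ parabolicTypes ∧
      eulerChar P ν = 0 ∧
      ∀ x : OnePoint ℂ, (a x = 0 ∧ ν x = ⊤) ∨
        ∃ n ∈ ({1, 2, 3, 4, 6} : Finset ℕ), (n : ℤ) * a x = K ∧ ν x = (n : ℕ∞) := by
  have hP (x : OnePoint ℂ) : x ∈ postcritical f ↔ a x ≠ K := h.mem_postcritical_iff x
  have hsum : ∑ x ∈ h.finite.toFinset, weightDefect (quotientWeight a K x) = 2 := by
    have hK : (K : ℚ) ≠ 0 := by exact_mod_cast h.pos.ne'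
    have : ∑ x ∈ h.finite.toFinset, ((K : ℚ) - a x) = 2 * K := by exact_mod_cast hdeg
    simp_rw [h.weightDefect_quotientWeight]
    rw [← Finset.sum_div, this, mul_div_cancel_right₀ _ hK]
  have hweight : IsWeight f (quotientWeight a K) :=
    ⟨h.one_le_quotientWeight, fun x hx => by
      rw [hP, not_not] at hx
      exact (h.quotientWeight_eq_one_iff x).2 hx⟩
  have htypes : h.finite.toFinset.val.map (quotientWeight a K) ∈ parabolicTypes := by
    refine mem_parabolicTypes_of_sum_weightDefect (fun n hn => ?_) ?_
    · obtain ⟨x, hx, rfl⟩ := Multiset.mem_map.1 hn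
      have hx' : a x ≠ K := by simpa using hx
      rw [Ne, ← h.quotientWeight_eq_one_iff] at hx'
      have := lt_of_le_of_ne (h.one_le_quotientWeight x) (Ne.symm hx')
      exact Order.add_one_le_of_lt this
    · rw [Multiset.map_map]
      exact hsum
  refine ⟨quotientWeight a K, h.finite.toFinset, ?_, ⟨⟨hweight, fun y => ?_⟩, ?_⟩,
    ⟨hweight, fun y => ?_⟩, htypes, ?_, fun x => ?_⟩
  · ext x
    simp [hP]
  · rw [h.quotientWeight_map]
  · exact fun μ hμ => h.quotientWeight_le hμ.1.1 hμ.2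
  · rw [h.quotientWeight_map]
  · rw [eulerChar, hsum, sub_self]
  · rcases eq_or_ne (a x) 0 with h0 | h0
    · exact Or.inl ⟨h0, quotientWeight_of_eq_zero h0⟩
    · obtain ⟨n, hn, h1⟩ := h.exists_mul_eq h0
      have hν : quotientWeight a K x = n := quotientWeight_of_mul_eq h0 h1
      refine Or.inr ⟨n, ?_, h1, hν⟩
      by_cases hx : a x = K
      · rw [(h.quotientWeight_eq_one_iff x).2 hx] at hν
        have : n = 1 := by exact_mod_cast hν.symm
        simp [this]
      · refine mem_of_mem_parabolicTypes htypes (Multiset.mem_map.2 ⟨x, ?_, hν⟩)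
        simpa using hx

open scoped Topology

/-! ### Orders of meromorphic functions of one complex variable -/

/-- The value of `φ` at `y` may be arbitrary, so `φ` is first replaced by an analytic function with
value `c` at `y` and the same values around `y`. -/
lemma meromorphicOrderAt_comp_of_sub {f φ : ℂ → ℂ} {c y : ℂ} {n : ℕ} (hn : n ≠ 0) {o : ℤ}
    (hφ : meromorphicOrderAt (fun z => φ z - c) y = ((n : ℤ) : WithTop ℤ))
    (hf : MeromorphicAt f c) (ho : meromorphicOrderAt f c = (o : WithTop ℤ)) :
    MeromorphicAt (f ∘ φ) y ∧ meromorphicOrderAt (f ∘ φ) y = ((n * o : ℤ) : WithTop ℤ) := by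
  have hn' : (0 : ℤ) < n := by omega
  have hφm : MeromorphicAt (fun z => φ z - c) y := by
    refine meromorphicAt_of_meromorphicOrderAt_ne_zero ?_
    rw [hφ]
    exact_mod_cast hn
  obtain ⟨g, hg, hgφ⟩ := hφm.meromorphicOrderAt_nonneg_iff.1 (by rw [hφ]; exact_mod_cast hn'.le)
  have hgo : analyticOrderAt g y = n := by
    rw [meromorphicOrderAt_congr hgφ, hg.meromorphicOrderAt_eq] at hφ
    induction h : analyticOrderAt g y with
    | top => simp [h] at hφ
    | coe m =>
      rw [h] at hφ
      have : (m : ℤ) = n := by simpa using hφ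
      exact_mod_cast this
  have hg0 : g y = 0 := by
    by_contra hne
    rw [hg.analyticOrderAt_eq_zero.2 hne] at hgo
    exact hn (by exact_mod_cast hgo.symm)
  set ψ : ℂ → ℂ := fun z => g z + c with hψ
  have hψy : ψ y = c := by simp [hψ, hg0]
  have hψa : AnalyticAt ℂ ψ y := by fun_prop
  have hcongr : f ∘ φ =ᶠ[𝓝[≠] y] f ∘ ψ := by
    filter_upwards [hgφ] with z hz
    simp [hψ, ← hz]
  have hψo : analyticOrderAt (ψ · - ψ y) y = n := by
    rw [← hgo]
    congr 1
    ext z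
    simp [hψ, hg0]
  rw [← hψy] at hf ho
  refine ⟨(hf.comp_analyticAt hψa).congr hcongr.symm, ?_⟩
  rw [meromorphicOrderAt_congr hcongr, hf.meromorphicOrderAt_comp hψa, hψo, ho]
  · rw [mul_comm]
    rfl
  · rw [eventuallyConst_iff_analyticOrderAt_sub_eq_top, hψo]
    exact ENat.natCast_ne_top n

lemma meromorphicOrderAt_mul_pow {g p : ℂ → ℂ} {y : ℂ} {m l : ℤ} (k : ℕ)
    (hg : MeromorphicAt g y) (hgo : meromorphicOrderAt g y = (m : WithTop ℤ))
    (hp : MeromorphicAt p y) (hpo : meromorphicOrderAt p y = (l : WithTop ℤ)) :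
    meromorphicOrderAt (fun z => g z * p z ^ k) y = ((m + k * l : ℤ) : WithTop ℤ) := by
  have : (fun z => g z * p z ^ k) = g * p ^ k := rfl
  rw [this, meromorphicOrderAt_mul hg (hp.pow k), meromorphicOrderAt_pow hp, hgo, hpo]
  rfl

lemma meromorphicOrderAt_neg_inv_sq :
    meromorphicOrderAt (fun w : ℂ => -(w ^ 2)⁻¹) 0 = ((-2 : ℤ) : WithTop ℤ) := by
  rw [meromorphicOrderAt_eq_int_iff (by fun_prop)]
  refine ⟨fun _ => -1, analyticAt_const, by simp, Eventually.of_forall fun w => ?_⟩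
  simp [zpow_neg]

lemma meromorphicOrderAt_const_mul {g : ℂ → ℂ} {y c : ℂ} (hc : c ≠ 0) :
    meromorphicOrderAt (fun z => c * g z) y = meromorphicOrderAt g y :=
  meromorphicOrderAt_mul_of_ne_zero (g := fun _ => c) analyticAt_const hc

/-- Functions that agree off a discrete set agree around `∞` if they are analytic there. -/
lemma eventuallyEq_inv_of_codiscrete {f g : ℂ → ℂ}
    (hf : ∀ᶠ w in 𝓝[≠] (0 : ℂ), AnalyticAt ℂ (fun w => f w⁻¹) w)
    (hg : ∀ᶠ w in 𝓝[≠] (0 : ℂ), AnalyticAt ℂ (fun w => g w⁻¹) w)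
    (h : f =ᶠ[codiscrete ℂ] g) :
    (fun w => f w⁻¹) =ᶠ[𝓝[≠] (0 : ℂ)] fun w => g w⁻¹ := by
  filter_upwards [hf, hg, self_mem_nhdsWithin] with w hfw hgw hw
  have hw0 : w ≠ 0 := hw
  -- Equality holds on a punctured neighbourhood of each point; continuity extends it to the point
  -- itself.
  have hmem : ∀ᶠ z in 𝓝[≠] w⁻¹, f z = g z := by
    have := mem_codiscrete.1 h w⁻¹
    rwa [disjoint_principal_right, compl_compl] at this
  have htend : Tendsto (fun w : ℂ => w⁻¹) (𝓝[≠] w) (𝓝[≠] w⁻¹) := by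
    refine tendsto_nhdsWithin_iff.2 ⟨(continuousAt_inv₀ hw0).mono_left nhdsWithin_le_nhds, ?_⟩
    filter_upwards [self_mem_nhdsWithin] with v hv
    exact fun hvw => hv (inv_injective hvw)
  exact ((hfw.continuousAt.eventuallyEq_nhds_iff_eventuallyEq_nhdsNE hgw.continuousAt).1
    (htend.eventually hmem)).eq_of_nhds

lemma meromorphicOrderAt_comp_inv {h : ℂ → ℂ} {w : ℂ} (hw : w ≠ 0) :
    meromorphicOrderAt (fun w => h w⁻¹) w = meromorphicOrderAt h w⁻¹ := by
  refine meromorphicOrderAt_comp_of_deriv_ne_zero (f := h) (g := fun w => w⁻¹)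
    (analyticAt_inv hw) ?_
  rw [deriv_inv]
  simpa using hw

/-! ### Divisors of meromorphic functions on the sphere -/

section Sphere

variable {h : ℂ → ℂ}

lemma exists_meromorphicOrderAt_ne_top (hnz : ¬ h =ᶠ[codiscrete ℂ] 0) :
    ∃ z, meromorphicOrderAt h z ≠ ⊤ := by
  by_contra! hcon
  refine hnz (mem_codiscrete.2 fun z => ?_)
  rw [disjoint_principal_right, compl_compl]
  exact meromorphicOrderAt_eq_top_iff.1 (hcon z)

lemma meromorphicOrderAt_ne_top (hm : ∀ z, MeromorphicAt h z) (hnz : ¬ h =ᶠ[codiscrete ℂ] 0)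
    (z : ℂ) : meromorphicOrderAt h z ≠ ⊤ := by
  obtain ⟨w, hw⟩ := exists_meromorphicOrderAt_ne_top hnz
  exact MeromorphicOn.meromorphicOrderAt_ne_top_of_isPreconnected (U := Set.univ)
    (fun z _ => hm z) isPreconnected_univ (Set.mem_univ w) (Set.mem_univ z) hw

/-- A function vanishing around `∞` would vanish around some finite point, contrary to the identity
theorem. -/
lemma meromorphicOrderAt_inv_ne_top (hm : ∀ z, MeromorphicAt h z)
    (hnz : ¬ h =ᶠ[codiscrete ℂ] 0) :
    meromorphicOrderAt (fun w => h w⁻¹) 0 ≠ ⊤ := by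
  intro htop
  have h1 := eventually_eventually_nhdsWithin.2 (meromorphicOrderAt_eq_top_iff.1 htop)
  obtain ⟨w, hw, hw0⟩ := (h1.and self_mem_nhdsWithin).exists
  have hw0 : w ≠ 0 := hw0
  refine meromorphicOrderAt_ne_top hm hnz w⁻¹ ?_
  rw [← meromorphicOrderAt_comp_inv hw0, meromorphicOrderAt_eq_top_iff]
  rw [eventually_nhdsWithin_iff] at hw
  rw [eventually_nhdsWithin_iff]
  filter_upwards [hw, eventually_ne_nhds hw0] with v hv hv0 _
  exact hv hv0

end Sphere

section Sphere

variable {h : ℂ → ℂ}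

/-- There are no zeros or poles near `∞`, so the set is bounded, and a discrete condition fails only
finitely often on a compact set. -/
lemma finite_meromorphicOrderAt_ne_zero (hm : ∀ z, MeromorphicAt h z)
    (hnz : ¬ h =ᶠ[codiscrete ℂ] 0) (hinf : MeromorphicAt (fun w => h w⁻¹) 0) :
    {z | meromorphicOrderAt h z ≠ 0}.Finite := by
  have hH := (meromorphicOrderAt_ne_top_iff_eventually_ne_zero hinf).1
    (meromorphicOrderAt_inv_ne_top hm hnz)
  have h0 : ∀ᶠ w in 𝓝[≠] (0 : ℂ), meromorphicOrderAt h w⁻¹ = 0 := by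
    filter_upwards [hH, hinf.eventually_analyticAt, self_mem_nhdsWithin] with w hw hwa hw0
    rw [← meromorphicOrderAt_comp_inv hw0, hwa.meromorphicOrderAt_eq,
      hwa.analyticOrderAt_eq_zero.2 hw]
    rfl
  have hcob : ∀ᶠ z in Bornology.cobounded ℂ, meromorphicOrderAt h z = 0 := by
    have := tendsto_inv₀_cobounded'.eventually h0
    simpa using this
  set S := {z | meromorphicOrderAt h z ≠ 0}
  have hSb : Bornology.IsBounded S := by
    rw [← Bornology.isCobounded_compl_iff]
    refine mem_of_superset hcob fun z hz => ?_
    simpa [S] using hz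
  have hK : IsCompact (closure S) := hSb.isCompact_closure
  have hcod := MeromorphicOn.codiscreteWithin_setOfPred_meromorphicOrderAt_eq_zero_or_top
    (U := closure S) (fun z _ => hm z) (fun z _ => meromorphicOrderAt_ne_top hm hnz z)
  refine (hK.finite_sdiff_of_mem_codiscreteWithin hcod).subset fun z hz => ⟨subset_closure hz, ?_⟩
  rintro ⟨-, h1 | h1⟩
  · exact hz h1
  · exact meromorphicOrderAt_ne_top hm hnz z h1

/-- An entire function without a pole at `∞` is constant. -/
lemma exists_eq_const_of_entire {g : ℂ → ℂ} (hg : Differentiable ℂ g)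
    (hinf : MeromorphicAt (fun w => g w⁻¹) 0)
    (ho : 0 ≤ meromorphicOrderAt (fun w => g w⁻¹) 0) : ∃ c, ∀ z, g z = c := by
  obtain ⟨c, hc⟩ := (tendsto_nhds_iff_meromorphicOrderAt_nonneg hinf).2 ho
  refine ⟨c, fun z => hg.apply_eq_of_tendsto_cocompact z ?_⟩
  rw [← Metric.cobounded_eq_cocompact]
  simpa [Function.comp_def] using hc.comp tendsto_inv₀_cobounded'

/-- Either `g` or `1 / g` is without a pole at `∞`, hence constant by Liouville's theorem. -/
lemma meromorphicOrderAt_inv_of_entire_ne_zero {g : ℂ → ℂ} (hg : Differentiable ℂ g)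
    (hg0 : ∀ z, g z ≠ 0) (hinf : MeromorphicAt (fun w => g w⁻¹) 0) :
    meromorphicOrderAt (fun w => g w⁻¹) 0 = 0 := by
  have of_const (c : ℂ) (hc : ∀ z, g z = c) : meromorphicOrderAt (fun w => g w⁻¹) 0 = 0 := by
    simp only [hc]
    have hc0 : c ≠ 0 := hc 0 ▸ hg0 0
    rw [analyticAt_const.meromorphicOrderAt_eq, analyticAt_const.analyticOrderAt_eq_zero.2 hc0]
    rfl
  rcases le_total 0 (meromorphicOrderAt (fun w => g w⁻¹) 0) with h1 | h1
  · obtain ⟨c, hc⟩ := exists_eq_const_of_entire hg hinf h1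
    exact of_const c hc
  · have hinv : meromorphicOrderAt (fun w => (g w⁻¹)⁻¹) 0
        = -meromorphicOrderAt (fun w => g w⁻¹) 0 := meromorphicOrderAt_inv
    obtain ⟨c, hc⟩ := exists_eq_const_of_entire (g := fun z => (g z)⁻¹) (hg.inv hg0) hinf.inv (by
      rw [hinv]
      induction h : meromorphicOrderAt (fun w => g w⁻¹) 0 with
      | top => simp [h] at h1
      | coe m =>
        rw [h] at h1
        have : m ≤ 0 := by exact_mod_cast h1
        have h2 : 0 ≤ -m := by omega
        exact_mod_cast h2)
    exact of_const c⁻¹ fun z => by rw [← hc z, inv_inv]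

lemma meromorphicOrderAt_inv_sub (u : ℂ) :
    meromorphicOrderAt (fun w : ℂ => w⁻¹ - u) 0 = ((-1 : ℤ) : WithTop ℤ) := by
  rw [meromorphicOrderAt_eq_int_iff (by fun_prop)]
  refine ⟨fun w => 1 - u * w, by fun_prop, by simp, ?_⟩
  filter_upwards [self_mem_nhdsWithin] with w hw
  have hw0 : w ≠ 0 := hw
  simp only [sub_zero, zpow_neg_one, smul_eq_mul]
  field_simp

/-- A meromorphic function on the sphere has as many zeros as poles. -/
theorem sum_meromorphicOrderAt (hm : ∀ z, MeromorphicAt h z)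
    (hnz : ¬ h =ᶠ[codiscrete ℂ] 0) (hinf : MeromorphicAt (fun w => h w⁻¹) 0) {S : Finset ℂ}
    (hS : ∀ z, meromorphicOrderAt h z ≠ 0 → z ∈ S) {d : ℂ → ℤ}
    (hd : ∀ z, meromorphicOrderAt h z = d z) {o : ℤ}
    (ho : meromorphicOrderAt (fun w => h w⁻¹) 0 = o) : ∑ z ∈ S, d z + o = 0 := by
  have hon : MeromorphicOn h Set.univ := fun z _ => hm z
  have hdiv (z : ℂ) : MeromorphicOn.divisor h Set.univ z = d z := by
    rw [MeromorphicOn.divisor_apply hon (Set.mem_univ z), hd]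
    rfl
  have hd0 (z : ℂ) (hz : d z ≠ 0) : z ∈ S := hS z (by rw [hd]; exact_mod_cast hz)
  have hsupp : (MeromorphicOn.divisor h Set.univ).support.Finite := by
    refine S.finite_toSet.subset fun z hz => ?_
    rw [Function.mem_support, hdiv] at hz
    exact hd0 z hz
  -- Dividing out the zeros and poles leaves a zero-free entire `g`, of order 0 at `∞`; each factor
  -- `z - u` has a simple pole there.
  obtain ⟨g, hg, hg0, hgeq⟩ := hon.extract_zeros_poles
    (fun z => meromorphicOrderAt_ne_top hm hnz z) hsupp
  have hprod : (∏ᶠ u : ℂ, (fun x => x - u) ^ (MeromorphicOn.divisor h Set.univ) u)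
      = fun x => ∏ u ∈ S, (x - u) ^ d u := by
    rw [finprod_eq_prod_of_mulSupport_subset (s := S)]
    · ext x
      simp [hdiv]
    · rw [Function.FactorizedRational.mulSupport]
      intro z hz
      rw [Function.mem_support, hdiv] at hz
      exact hd0 z hz
  rw [hprod] at hgeq
  set Φ : ℂ → ℂ := fun x => ∏ u ∈ S, (x - u) ^ d u with hΦ
  have hfac (u : ℂ) : MeromorphicAt (fun w : ℂ => (w⁻¹ - u) ^ d u) 0 := by fun_prop
  have hΦm : MeromorphicAt (fun w => Φ w⁻¹) 0 := MeromorphicAt.fun_prod fun u _ => hfac u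
  have hΦo : meromorphicOrderAt (fun w => Φ w⁻¹) 0 = ((-∑ u ∈ S, d u : ℤ) : WithTop ℤ) := by
    rw [hΦ, meromorphicOrderAt_fun_prod fun u _ => hfac u, ← Finset.sum_neg_distrib]
    push_cast
    refine Finset.sum_congr rfl fun u _ => ?_
    have : (fun w : ℂ => (w⁻¹ - u) ^ d u) = (fun w : ℂ => w⁻¹ - u) ^ d u := rfl
    rw [this, meromorphicOrderAt_zpow (by fun_prop), meromorphicOrderAt_inv_sub,
      ← WithTop.coe_mul, mul_neg_one]
    rfl
  have hgd : Differentiable ℂ g := fun z => (hg z (Set.mem_univ z)).differentiableAt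
  have hginf : ∀ᶠ w in 𝓝[≠] (0 : ℂ), AnalyticAt ℂ (fun w => g w⁻¹) w := by
    filter_upwards [self_mem_nhdsWithin] with w hw
    exact (hg w⁻¹ (Set.mem_univ _)).comp (analyticAt_inv hw)
  have heq : (fun w => h w⁻¹) =ᶠ[𝓝[≠] (0 : ℂ)] fun w => Φ w⁻¹ * g w⁻¹ := by
    refine eventuallyEq_inv_of_codiscrete (g := Φ • g) hinf.eventually_analyticAt ?_ hgeq
    filter_upwards [hginf, hΦm.eventually_analyticAt] with w h1 h2
    exact h2.mul h1
  have hΦ0 : ∀ᶠ w in 𝓝[≠] (0 : ℂ), Φ w⁻¹ ≠ 0 :=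
    (meromorphicOrderAt_ne_top_iff_eventually_ne_zero hΦm).1 (by rw [hΦo]; exact WithTop.coe_ne_top)
  have hgm : MeromorphicAt (fun w => g w⁻¹) 0 := by
    refine (hinf.div hΦm).congr ?_
    filter_upwards [heq, hΦ0] with w h1 h2
    rw [Pi.div_apply, h1, mul_div_cancel_left₀ _ h2]
  have hgo := meromorphicOrderAt_inv_of_entire_ne_zero hgd (fun z => hg0 ⟨z, Set.mem_univ z⟩) hgm
  have hmul : meromorphicOrderAt (fun w => Φ w⁻¹ * g w⁻¹) 0
      = meromorphicOrderAt (fun w => Φ w⁻¹) 0 + meromorphicOrderAt (fun w => g w⁻¹) 0 :=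
    meromorphicOrderAt_mul hΦm hgm
  rw [← meromorphicOrderAt_congr heq, ho, hΦo, hgo, add_zero] at hmul
  have : o = -∑ u ∈ S, d u := by exact_mod_cast hmul
  omega

end Sphere

/-! ### Orders and degree of a section -/

namespace MeroDifferential

variable {k : ℕ} (q : MeroDifferential k)

lemma meromorphicAt_coeff_inv : MeromorphicAt (fun w => q.coeff w⁻¹) 0 := by
  have hp : MeromorphicAt (fun w : ℂ => (-(w ^ 2)⁻¹) ^ k) 0 := by fun_prop
  refine (q.meromorphic_infty.div hp).congr ?_
  filter_upwards [self_mem_nhdsWithin] with w hw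
  have hw0 : w ≠ 0 := hw
  rw [Pi.div_apply, mul_div_cancel_right₀]
  exact pow_ne_zero _ (neg_ne_zero.2 (inv_ne_zero (pow_ne_zero _ hw0)))

variable {q}

lemma ord_ne_top (hq : q.IsNonzero) (x : OnePoint ℂ) : q.ord x ≠ ⊤ := by
  induction x with
  | infty =>
    obtain ⟨o, ho⟩ := WithTop.ne_top_iff_exists.1
      (meromorphicOrderAt_inv_ne_top q.meromorphic hq)
    have := meromorphicOrderAt_mul_pow k q.meromorphicAt_coeff_inv ho.symm (by fun_prop)
      meromorphicOrderAt_neg_inv_sq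
    show meromorphicOrderAt q.coeffInfty 0 ≠ ⊤
    unfold coeffInfty
    rw [this]
    exact WithTop.coe_ne_top
  | coe z => exact meromorphicOrderAt_ne_top q.meromorphic hq z

/-- The order of a non-zero meromorphic section as an integer. -/
def intOrd (q : MeroDifferential k) (x : OnePoint ℂ) : ℤ := (q.ord x).untopD 0

lemma coe_intOrd (hq : q.IsNonzero) (x : OnePoint ℂ) : q.ord x = (q.intOrd x : WithTop ℤ) := by
  obtain ⟨m, hm⟩ := WithTop.ne_top_iff_exists.1 (ord_ne_top hq x)
  rw [intOrd, ← hm]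
  rfl

lemma meromorphicOrderAt_coeff (hq : q.IsNonzero) (z : ℂ) :
    meromorphicOrderAt q.coeff z = (q.intOrd z : WithTop ℤ) := coe_intOrd hq z

/-- The factor `(-w⁻²)^k` has order `-2k`; this shift is the source of the degree of the divisor. -/
lemma meromorphicOrderAt_coeff_inv (hq : q.IsNonzero) :
    meromorphicOrderAt (fun w => q.coeff w⁻¹) 0 = ((q.intOrd ∞ + 2 * k : ℤ) : WithTop ℤ) := by
  obtain ⟨o, ho⟩ := WithTop.ne_top_iff_exists.1
    (meromorphicOrderAt_inv_ne_top q.meromorphic hq)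
  have h1 := meromorphicOrderAt_mul_pow k q.meromorphicAt_coeff_inv ho.symm (by fun_prop)
    meromorphicOrderAt_neg_inv_sq
  have h2 : meromorphicOrderAt q.coeffInfty 0 = _ := coe_intOrd hq ∞
  unfold coeffInfty at h2
  rw [h1] at h2
  have h3 : o + k * (-2) = q.intOrd ∞ := by exact_mod_cast h2
  rw [← ho]
  congr 1
  omega

lemma finite_intOrd_ne_zero (hq : q.IsNonzero) : {x | q.intOrd x ≠ 0}.Finite := by
  have h1 := finite_meromorphicOrderAt_ne_zero q.meromorphic hq q.meromorphicAt_coeff_inv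
  refine ((h1.image (fun z : ℂ => (z : OnePoint ℂ))).union (Set.finite_singleton ∞)).subset
    fun x hx => ?_
  induction x with
  | infty => exact Or.inr rfl
  | coe z =>
    refine Or.inl ⟨z, ?_, rfl⟩
    show meromorphicOrderAt q.coeff z ≠ 0
    rw [meromorphicOrderAt_coeff hq]
    exact_mod_cast hx

/-- The degree of the divisor of a section of the `k`-th power of the cotangent bundle. -/
theorem sum_intOrd (hq : q.IsNonzero) :
    ∑ x ∈ (finite_intOrd_ne_zero hq).toFinset, q.intOrd x = -(2 * k) := by
  classical
  have h1 := finite_meromorphicOrderAt_ne_zero q.meromorphic hq q.meromorphicAt_coeff_inv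
  have h2 := sum_meromorphicOrderAt q.meromorphic hq q.meromorphicAt_coeff_inv
    (S := h1.toFinset) (fun z hz => by simpa using hz) (meromorphicOrderAt_coeff hq)
    (meromorphicOrderAt_coeff_inv hq)
  set T : Finset (OnePoint ℂ) := insert ∞ (h1.toFinset.image fun z : ℂ => (z : OnePoint ℂ)) with hT
  have h3 : ∑ x ∈ (finite_intOrd_ne_zero hq).toFinset, q.intOrd x = ∑ x ∈ T, q.intOrd x := by
    refine Finset.sum_subset (fun x hx => ?_) fun x _ hx => ?_
    · induction x with
      | infty => simp [hT]
      | coe z =>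
        have hx' : q.intOrd z ≠ 0 := by simpa using hx
        refine Finset.mem_insert_of_mem (Finset.mem_image_of_mem _ ?_)
        rw [Set.Finite.mem_toFinset]
        show meromorphicOrderAt q.coeff z ≠ 0
        rw [meromorphicOrderAt_coeff hq]
        exact_mod_cast hx'
    · simpa using hx
  rw [h3, hT, Finset.sum_insert (by simp), Finset.sum_image (by simp)]
  omega

end MeroDifferential

/-! ### Pull-back of sections -/

/-- The meromorphic map `φ` to the sphere takes the value `x` at `y` with multiplicity `n`. -/
def TakesValue (φ : ℂ → ℂ) (y : ℂ) (n : ℕ) : OnePoint ℂ → Prop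
  | (c : ℂ) => meromorphicOrderAt (fun z => φ z - c) y = ((n : ℤ) : WithTop ℤ)
  | ∞ => meromorphicOrderAt φ y = ((-n : ℤ) : WithTop ℤ)

namespace MeroDifferential

variable {k : ℕ} {q : MeroDifferential k}

/-- The order of the pull-back of a section. -/
theorem meromorphicOrderAt_pullback (hq : q.IsNonzero) {φ : ℂ → ℂ} {y : ℂ} {n : ℕ} (hn : n ≠ 0)
    {x : OnePoint ℂ} (hφ : TakesValue φ y n x) :
    MeromorphicAt (fun z => q.coeff (φ z) * deriv φ z ^ k) y ∧
      meromorphicOrderAt (fun z => q.coeff (φ z) * deriv φ z ^ k) y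
        = ((n * (q.intOrd x + k) - k : ℤ) : WithTop ℤ) := by
  have hnZ : (n : ℤ) ≠ 0 := by exact_mod_cast hn
  have hnC : ((n : ℤ) : ℂ) ≠ 0 := by exact_mod_cast hn
  induction x with
  | infty =>
    have hφo : meromorphicOrderAt φ y = ((-n : ℤ) : WithTop ℤ) := hφ
    have hφm : MeromorphicAt φ y := by
      refine meromorphicAt_of_meromorphicOrderAt_ne_zero ?_
      rw [hφo]
      exact_mod_cast neg_ne_zero.2 hnZ
    -- In the target coordinate `1 / z` the map vanishes to order `n`. The coefficient contributes
    -- `n * (ord + 2k)` and the derivative of `φ` contributes `k * (-n - 1)`.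
    have hinv : meromorphicOrderAt (fun z => (φ z)⁻¹ - 0) y = ((n : ℤ) : WithTop ℤ) := by
      simp only [sub_zero]
      have : (fun z => (φ z)⁻¹) = φ⁻¹ := rfl
      rw [this, meromorphicOrderAt_inv, hφo]
      simp [← WithTop.LinearOrderedAddCommGroup.coe_neg]
    obtain ⟨h1, h2⟩ := meromorphicOrderAt_comp_of_sub hn hinv q.meromorphicAt_coeff_inv
      (meromorphicOrderAt_coeff_inv hq)
    have hcomp : ((fun w => q.coeff w⁻¹) ∘ fun z => (φ z)⁻¹) = fun z => q.coeff (φ z) := by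
      ext z
      simp
    rw [hcomp] at h1 h2
    have h3 := meromorphicOrderAt_deriv_eq_sub_one (by push_cast; simpa using hn) hφo
    refine ⟨h1.mul (hφm.deriv.pow k), ?_⟩
    rw [meromorphicOrderAt_mul_pow k h1 h2 hφm.deriv h3]
    congr 1
    ring
  | coe c =>
    have hφo : meromorphicOrderAt (fun z => φ z - c) y = ((n : ℤ) : WithTop ℤ) := hφ
    have hφm : MeromorphicAt (fun z => φ z - c) y := by
      refine meromorphicAt_of_meromorphicOrderAt_ne_zero ?_
      rw [hφo]
      exact_mod_cast hnZ
    have hderiv : deriv (fun z => φ z - c) = deriv φ := by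
      ext z
      exact deriv_sub_const c
    obtain ⟨h1, h2⟩ := meromorphicOrderAt_comp_of_sub hn hφo (q.meromorphic c)
      (meromorphicOrderAt_coeff hq c)
    have h3 := meromorphicOrderAt_deriv_eq_sub_one hnC hφo
    have h4 := hφm.deriv
    rw [hderiv] at h3 h4
    refine ⟨h1.mul (h4.pow k), ?_⟩
    have := meromorphicOrderAt_mul_pow k h1 h2 h4 h3
    simp only [Function.comp_apply] at this
    rw [this]
    congr 1
    ring

end MeroDifferential

/-! ### Polynomials as meromorphic functions -/

lemma analyticAt_eval (P : ℂ[X]) (z : ℂ) : AnalyticAt ℂ (fun w => P.eval w) z :=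
  P.differentiable.analyticAt z

lemma meromorphicOrderAt_eval {P : ℂ[X]} (hP : P ≠ 0) (z : ℂ) :
    meromorphicOrderAt (fun w => P.eval w) z = ((P.rootMultiplicity z : ℤ) : WithTop ℤ) := by
  obtain ⟨Q, hQ, hQz⟩ := Polynomial.exists_eq_pow_rootMultiplicity_mul_and_not_dvd P hP z
  rw [meromorphicOrderAt_eq_int_iff (analyticAt_eval P z).meromorphicAt]
  refine ⟨fun w => Q.eval w, analyticAt_eval Q z, fun h => hQz (dvd_iff_isRoot.2 h),
    Eventually.of_forall fun w => ?_⟩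
  conv_lhs => rw [hQ]
  simp

lemma meromorphicAt_eval_inv (P : ℂ[X]) : MeromorphicAt (fun w => P.eval w⁻¹) 0 := by
  simp only [eval_eq_sum_range]
  fun_prop

/-- `P(1/w)` is `w ^ (-deg P)` times the reversed polynomial, whose value at 0 is the leading
coefficient. -/
lemma meromorphicOrderAt_eval_inv {P : ℂ[X]} (hP : P ≠ 0) :
    meromorphicOrderAt (fun w => P.eval w⁻¹) 0 = ((-P.natDegree : ℤ) : WithTop ℤ) := by
  rw [meromorphicOrderAt_eq_int_iff (meromorphicAt_eval_inv P)]
  refine ⟨fun w => P.reverse.eval w, analyticAt_eval _ _, ?_, ?_⟩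
  · show P.reverse.eval 0 ≠ 0
    rw [← coeff_zero_eq_eval_zero, coeff_zero_reverse]
    exact leadingCoeff_ne_zero.2 hP
  · filter_upwards [self_mem_nhdsWithin] with w hw
    have hw0 : w ≠ 0 := hw
    let _ : Invertible w⁻¹ := invertibleOfNonzero (inv_ne_zero hw0)
    have := eval₂_reverse_mul_pow (RingHom.id ℂ) w⁻¹ P
    rw [invOf_eq_inv, inv_inv] at this
    simp only [eval₂_id] at this
    rw [← this, sub_zero, zpow_neg, zpow_natCast, smul_eq_mul, inv_pow, mul_comm]

lemma meromorphicOrderAt_div_of_eq {g p r : ℂ → ℂ} {y : ℂ} {m l : ℤ}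
    (hp : MeromorphicAt p y) (hpo : meromorphicOrderAt p y = (m : WithTop ℤ))
    (hr : MeromorphicAt r y) (hro : meromorphicOrderAt r y = (l : WithTop ℤ))
    (hg : ∀ z, r z ≠ 0 → g z = p z / r z) :
    meromorphicOrderAt g y = ((m - l : ℤ) : WithTop ℤ) := by
  have hr0 : ∀ᶠ z in 𝓝[≠] y, r z ≠ 0 :=
    (meromorphicOrderAt_ne_top_iff_eventually_ne_zero hr).1 (by rw [hro]; exact WithTop.coe_ne_top)
  have hcongr : g =ᶠ[𝓝[≠] y] p / r := by
    filter_upwards [hr0] with z hz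
    exact hg z hz
  rw [meromorphicOrderAt_congr hcongr, meromorphicOrderAt_div hp hr, hpo, hro]
  rfl

/-! ### Fibres and local degrees of a rational map -/

section RationalMap

variable {f : RatFunc ℂ}

lemma num_eval_ne_zero {z : ℂ} (hz : f.denom.eval z = 0) : f.num.eval z ≠ 0 := by
  obtain ⟨a, b, hab⟩ := f.isCoprime_num_denom
  intro h
  have := congrArg (eval z) hab
  simp [hz, h] at this

lemma natDegree_num_le : f.num.natDegree ≤ ratDegree f := le_max_left _ _

lemma natDegree_denom_le : f.denom.natDegree ≤ ratDegree f := le_max_right _ _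

lemma fiberPoly_ne_zero (hf : 0 < ratDegree f) (x : OnePoint ℂ) : fiberPoly f x ≠ 0 := by
  induction x with
  | infty => exact f.denom_ne_zero
  | coe c =>
    intro h
    have h1 : f.num = C c * f.denom := sub_eq_zero.1 h
    have hunit : IsUnit f.denom :=
      f.isCoprime_num_denom.isUnit_of_dvd' (h1 ▸ dvd_mul_left _ _) dvd_rfl
    have h2 : f.denom.natDegree = 0 := natDegree_eq_zero_of_isUnit hunit
    have h3 : f.num.natDegree = 0 := by
      have := natDegree_C_mul_le c f.denom
      rw [← h1, h2] at this
      omega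
    rw [ratDegree, h2, h3] at hf
    simp at hf

lemma natDegree_fiberPoly_le (x : OnePoint ℂ) : (fiberPoly f x).natDegree ≤ ratDegree f := by
  induction x with
  | infty => exact natDegree_denom_le
  | coe c =>
    exact (natDegree_sub_le _ _).trans
      (max_le_max le_rfl (natDegree_C_mul_le _ _))

lemma coeff_ratDegree_eq_zero_iff {P : ℂ[X]} (hf : 0 < ratDegree f)
    (hd : P.natDegree ≤ ratDegree f) : P.coeff (ratDegree f) = 0 ↔ P.natDegree < ratDegree f := by
  refine ⟨fun h => lt_of_le_of_ne hd fun he => ?_, coeff_eq_zero_of_natDegree_lt⟩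
  rw [← he, coeff_natDegree, leadingCoeff_eq_zero] at h
  -- The zero polynomial has `natDegree` 0, which positivity of `ratDegree f` excludes here.
  rw [h, natDegree_zero] at he
  omega

lemma sphereMap_coe_eq_iff (z : ℂ) (x : OnePoint ℂ) :
    sphereMap f z = x ↔ (fiberPoly f x).eval z = 0 := by
  have hdef : sphereMap f z = if f.denom.eval z = 0 then ∞
    else ((f.num.eval z / f.denom.eval z : ℂ) : OnePoint ℂ) := rfl
  rw [hdef]
  induction x with
  | infty =>
    show _ ↔ f.denom.eval z = 0
    split_ifs with h <;> simp [h]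
  | coe c =>
    show _ ↔ (f.num - C c * f.denom).eval z = 0
    split_ifs with h
    · simp [h, num_eval_ne_zero h]
    · rw [OnePoint.coe_eq_coe, div_eq_iff h, eval_sub, eval_mul, eval_C, sub_eq_zero]

lemma sphereMap_infty_eq_iff (hf : 0 < ratDegree f) (x : OnePoint ℂ) :
    sphereMap f ∞ = x ↔ (fiberPoly f x).natDegree < ratDegree f := by
  rw [← coeff_ratDegree_eq_zero_iff hf (natDegree_fiberPoly_le x)]
  have hdef : sphereMap f ∞ = if f.denom.coeff (ratDegree f) = 0 then ∞
    else ((f.num.coeff (ratDegree f) / f.denom.coeff (ratDegree f) : ℂ) : OnePoint ℂ) := rfl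
  rw [hdef]
  induction x with
  | infty =>
    show _ ↔ f.denom.coeff (ratDegree f) = 0
    split_ifs with h <;> simp [h]
  | coe c =>
    show _ ↔ (f.num - C c * f.denom).coeff (ratDegree f) = 0
    split_ifs with h
    -- Numerator and denominator cannot both have degree below their maximum.
    · have hnum : f.num.coeff (ratDegree f) ≠ 0 := by
        rw [coeff_ratDegree_eq_zero_iff hf natDegree_denom_le] at h
        rw [Ne, coeff_ratDegree_eq_zero_iff hf natDegree_num_le]
        have : ratDegree f = max f.num.natDegree f.denom.natDegree := rfl
        omega
      simp [h, hnum]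
    · rw [OnePoint.coe_eq_coe, div_eq_iff h, coeff_sub, coeff_C_mul, sub_eq_zero]

lemma localDegree_coe (z : ℂ) :
    localDegree f z = (fiberPoly f (sphereMap f z)).rootMultiplicity z := rfl

lemma localDegree_infty :
    localDegree f ∞ = ratDegree f - (fiberPoly f (sphereMap f ∞)).natDegree := rfl

lemma one_le_localDegree (hf : 0 < ratDegree f) (y : OnePoint ℂ) : 1 ≤ localDegree f y := by
  induction y with
  | infty =>
    have := (sphereMap_infty_eq_iff hf _).1 rfl
    rw [localDegree_infty]
    omega
  | coe z =>
    rw [localDegree_coe]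
    exact (rootMultiplicity_pos (fiberPoly_ne_zero hf _)).2 ((sphereMap_coe_eq_iff z _).1 rfl)

lemma exists_sphereMap_coe_eq {x : OnePoint ℂ} (h : 0 < (fiberPoly f x).natDegree) :
    ∃ z : ℂ, sphereMap f z = x := by
  obtain ⟨z, hz⟩ := IsAlgClosed.exists_root (fiberPoly f x) (natDegree_pos_iff_degree_pos.1 h).ne'
  exact ⟨z, (sphereMap_coe_eq_iff z x).2 hz⟩

lemma sphereMap_surjective (hf : 0 < ratDegree f) : (sphereMap f).Surjective := by
  intro x
  rcases (natDegree_fiberPoly_le (f := f) x).lt_or_eq with h | h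
  · exact ⟨∞, (sphereMap_infty_eq_iff hf x).2 h⟩
  · obtain ⟨z, hz⟩ := exists_sphereMap_coe_eq (f := f) (x := x) (by omega)
    exact ⟨z, hz⟩

/-- A point that is alone in its fibre is totally ramified. -/
lemma localDegree_eq_ratDegree (hf : 0 < ratDegree f) {y : OnePoint ℂ}
    (hy : ∀ z, sphereMap f z = sphereMap f y → z = y) : localDegree f y = ratDegree f := by
  induction y with
  | infty =>
    rw [localDegree_infty]
    have : ¬ 0 < (fiberPoly f (sphereMap f ∞)).natDegree := fun h => by
      obtain ⟨z, hz⟩ := exists_sphereMap_coe_eq h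
      exact OnePoint.coe_ne_infty z (hy z hz)
    omega
  | coe z =>
    set P := fiberPoly f (sphereMap f z) with hP
    have hP0 : P ≠ 0 := fiberPoly_ne_zero hf _
    -- A drop in degree would put `∞` into the fibre.
    have hdeg : P.natDegree = ratDegree f := by
      refine (natDegree_fiberPoly_le _).lt_or_eq.resolve_left fun h => ?_
      exact OnePoint.infty_ne_coe z (hy ∞ ((sphereMap_infty_eq_iff hf _).2 h))
    have hroots : P.roots = Multiset.replicate P.roots.card z :=
      Multiset.eq_replicate_card.2 fun w hw =>
        OnePoint.coe_injective (hy w ((sphereMap_coe_eq_iff w _).2 ((mem_roots hP0).1 hw)))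
    rw [localDegree_coe, ← hP, ← count_roots, hroots, Multiset.count_replicate_self,
      IsAlgClosed.card_roots_eq_natDegree, hdeg]

lemma affineMap_sub_eq (c : ℂ) {z : ℂ} (hz : f.denom.eval z ≠ 0) :
    affineMap f z - c = (fiberPoly f (c : OnePoint ℂ)).eval z / f.denom.eval z := by
  show _ = (f.num - C c * f.denom).eval z / f.denom.eval z
  rw [affineMap, eval_sub, eval_mul, eval_C]
  field_simp

lemma num_ne_zero_of_ratDegree_pos (hf : 0 < ratDegree f) : f.num ≠ 0 := by
  have : f.num - C 0 * f.denom ≠ 0 := fiberPoly_ne_zero hf ((0 : ℂ) : OnePoint ℂ)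
  rwa [C_0, zero_mul, sub_zero] at this

/-- By coprimality only one of `fiberPoly` and the denominator matters at `z`: at a pole the
numerator has order 0, elsewhere the denominator has. -/
theorem takesValue_affineMap (hf : 0 < ratDegree f) (z : ℂ) :
    TakesValue (affineMap f) z (localDegree f z) (sphereMap f z) := by
  rw [localDegree_coe]
  have hroot := (sphereMap_coe_eq_iff (f := f) z _).1 rfl
  have hne := fiberPoly_ne_zero hf (sphereMap f z)
  have hd := meromorphicOrderAt_eval f.denom_ne_zero z
  induction hx : sphereMap f z with
  | infty =>
    rw [hx] at hroot
    have h0 : f.num.rootMultiplicity z = 0 :=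
      rootMultiplicity_eq_zero (num_eval_ne_zero hroot)
    have := meromorphicOrderAt_div_of_eq (g := affineMap f)
      (analyticAt_eval _ z).meromorphicAt
      (meromorphicOrderAt_eval (num_ne_zero_of_ratDegree_pos hf) z)
      (analyticAt_eval _ z).meromorphicAt hd
      fun w _ => rfl
    rw [h0] at this
    simpa [TakesValue, fiberPoly] using this
  | coe c =>
    have h0 : f.denom.rootMultiplicity z = 0 := by
      refine rootMultiplicity_eq_zero fun h => ?_
      rw [(sphereMap_coe_eq_iff z ∞).2 h] at hx
      exact OnePoint.infty_ne_coe c hx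
    rw [hx] at hne
    have := meromorphicOrderAt_div_of_eq (g := fun w => affineMap f w - c)
      (analyticAt_eval _ z).meromorphicAt (meromorphicOrderAt_eval hne z)
      (analyticAt_eval _ z).meromorphicAt hd fun w hw => affineMap_sub_eq c hw
    rw [h0] at this
    simpa [TakesValue] using this

theorem takesValue_affineMap_inv (hf : 0 < ratDegree f) :
    TakesValue (fun w => affineMap f w⁻¹) 0 (localDegree f ∞) (sphereMap f ∞) := by
  rw [localDegree_infty]
  have hlt := (sphereMap_infty_eq_iff (f := f) hf _).1 rfl
  have hne := fiberPoly_ne_zero hf (sphereMap f ∞)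
  have hd := meromorphicOrderAt_eval_inv f.denom_ne_zero
  have hmax : ratDegree f = max f.num.natDegree f.denom.natDegree := rfl
  induction hx : sphereMap f ∞ with
  | infty =>
    rw [hx] at hlt
    have hlt' : f.denom.natDegree < ratDegree f := hlt
    have := meromorphicOrderAt_div_of_eq (g := fun w => affineMap f w⁻¹)
      (meromorphicAt_eval_inv _) (meromorphicOrderAt_eval_inv (num_ne_zero_of_ratDegree_pos hf))
      (meromorphicAt_eval_inv _) hd fun w _ => rfl
    show meromorphicOrderAt _ _ = ((-(ratDegree f - f.denom.natDegree : ℕ) : ℤ) : WithTop ℤ)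
    rw [this]
    congr 1
    omega
  | coe c =>
    have h0 : f.denom.natDegree = ratDegree f := by
      refine natDegree_denom_le.lt_or_eq.resolve_left fun h => ?_
      rw [(sphereMap_infty_eq_iff hf ∞).2 h] at hx
      exact OnePoint.infty_ne_coe c hx
    rw [hx] at hne hlt
    have := meromorphicOrderAt_div_of_eq (g := fun w => affineMap f w⁻¹ - c)
      (meromorphicAt_eval_inv _) (meromorphicOrderAt_eval_inv hne)
      (meromorphicAt_eval_inv _) hd fun w hw => affineMap_sub_eq c hw
    show meromorphicOrderAt _ _ = ((ratDegree f - (fiberPoly f (c : OnePoint ℂ)).natDegree : ℕ) : ℤ)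
    rw [this]
    congr 1
    omega

end RationalMap

/-! ### Parallel sections -/

namespace MeroDifferential

variable {f : RatFunc ℂ} {k : ℕ} {q : MeroDifferential k} {lam : ℂ}

lemma deriv_affineMap_inv :
    ∀ᶠ w in 𝓝[≠] (0 : ℂ), deriv (fun w => affineMap f w⁻¹) w
      = deriv (affineMap f) w⁻¹ * -(w ^ 2)⁻¹ := by
  have hd0 : ∀ᶠ w in 𝓝[≠] (0 : ℂ), f.denom.eval w⁻¹ ≠ 0 :=
    (meromorphicOrderAt_ne_top_iff_eventually_ne_zero (meromorphicAt_eval_inv _)).1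
      (by rw [meromorphicOrderAt_eval_inv f.denom_ne_zero]; exact WithTop.coe_ne_top)
  filter_upwards [hd0, self_mem_nhdsWithin] with w hw hw0
  have hw0 : w ≠ 0 := hw0
  have hdiff : DifferentiableAt ℂ (affineMap f) w⁻¹ := by
    unfold affineMap
    exact (Polynomial.differentiableAt _).div (Polynomial.differentiableAt _) hw
  exact (hdiff.hasDerivAt.comp w (hasDerivAt_inv hw0)).deriv

/-- A parallel section in the coordinate `w = 1 / z`. -/
lemma IsParallel.eventuallyEq_infty (hf : 0 < ratDegree f) (hq : q.IsNonzero)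
    (hpar : q.IsParallel f lam) :
    (fun w => q.coeff (affineMap f w⁻¹) * deriv (fun w => affineMap f w⁻¹) w ^ k)
      =ᶠ[𝓝[≠] 0] fun w => lam * q.coeffInfty w := by
  have hn := Nat.one_le_iff_ne_zero.1 (one_le_localDegree hf ∞)
  obtain ⟨hm, -⟩ := meromorphicOrderAt_pullback hq hn (takesValue_affineMap_inv hf)
  have hp : MeromorphicAt (fun w : ℂ => (-(w ^ 2)⁻¹) ^ k) 0 := by fun_prop
  -- Equality off a discrete set of `ℂ` says nothing near `∞` by itself; meromorphy of both sides
  -- there makes it hold on a punctured neighbourhood.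
  have hpull : MeromorphicAt (fun w => pullbackCoeff f q w⁻¹) 0 := by
    refine (hm.div hp).congr ?_
    filter_upwards [deriv_affineMap_inv (f := f), self_mem_nhdsWithin] with w hw hw0
    have hw0 : w ≠ 0 := hw0
    rw [Pi.div_apply, hw, mul_pow, ← mul_assoc, mul_div_cancel_right₀]
    · rfl
    · exact pow_ne_zero _ (neg_ne_zero.2 (inv_ne_zero (pow_ne_zero _ hw0)))
  have hlam : MeromorphicAt (fun w => lam * q.coeff w⁻¹) 0 :=
    (MeromorphicAt.const lam 0).mul q.meromorphicAt_coeff_inv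
  filter_upwards [deriv_affineMap_inv (f := f), eventuallyEq_inv_of_codiscrete
    hpull.eventually_analyticAt hlam.eventually_analyticAt hpar] with w hw heq
  rw [hw, mul_pow, ← mul_assoc, coeffInfty, ← mul_assoc, ← heq]
  rfl

/-- `ord_y q + k = deg_y f (ord_{f y} q + k)` for a parallel section. -/
theorem intOrd_add_eq (hf : 0 < ratDegree f) (hq : q.IsNonzero) (hlam : lam ≠ 0)
    (hpar : q.IsParallel f lam) (y : OnePoint ℂ) :
    q.intOrd y + k = localDegree f y * (q.intOrd (sphereMap f y) + k) := by
  have hn := Nat.one_le_iff_ne_zero.1 (one_le_localDegree hf y)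
  suffices h : q.ord y
      = ((localDegree f y * (q.intOrd (sphereMap f y) + k) - k : ℤ) : WithTop ℤ) by
    rw [coe_intOrd hq] at h
    have : q.intOrd y = localDegree f y * (q.intOrd (sphereMap f y) + k) - k := by
      exact_mod_cast h
    omega
  induction y with
  | infty =>
    rw [← (meromorphicOrderAt_pullback hq hn (takesValue_affineMap_inv hf)).2,
      meromorphicOrderAt_congr (hpar.eventuallyEq_infty hf hq), meromorphicOrderAt_const_mul hlam]
    rfl
  | coe z =>
    have heq : pullbackCoeff f q =ᶠ[𝓝[≠] z] fun z => lam * q.coeff z := by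
      have := mem_codiscrete.1 hpar z
      rwa [disjoint_principal_right, compl_compl] at this
    have h := meromorphicOrderAt_congr heq
    rw [meromorphicOrderAt_const_mul hlam] at h
    exact h.symm.trans (meromorphicOrderAt_pullback hq hn (takesValue_affineMap hf z)).2

theorem isScaledOrder (hf : 1 < ratDegree f) (hk : 0 < k) (hq : q.IsNonzero) (hlam : lam ≠ 0)
    (hpar : q.IsParallel f lam) :
    IsScaledOrder (sphereMap f) (localDegree f) (fun x => q.intOrd x + k) k where
  surjective := sphereMap_surjective (by omega)
  one_le := one_le_localDegree (by omega)
  -- The hypothesis that the degree exceeds 1 is decisive here: total ramification is genuine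
  -- ramification.
  one_lt y hy := by rwa [localDegree_eq_ratDegree (by omega) hy]
  scaled := intOrd_add_eq (by omega) hq hlam hpar
  finite := by simpa using finite_intOrd_ne_zero hq
  pos := hk

end MeroDifferential

end ParallelTensor

end

theorem lemma3p3 (f : RatFunc ℂ) (hf : 1 < ParallelTensor.ratDegree f)
    (k : ℕ) (hk : 0 < k) (q : ParallelTensor.MeroDifferential k) (hq : q.IsNonzero)
    (lam : ℂ) (hlam : lam ≠ 0) (hpar : q.IsParallel f lam) :
    ∃ (ν : OnePoint ℂ → ℕ∞) (P : Finset (OnePoint ℂ)),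
      (P : Set (OnePoint ℂ)) = ParallelTensor.postcritical f ∧
      ParallelTensor.IsCanonicalWeight f ν ∧
      ParallelTensor.PreservesOrbifold f ν ∧
      P.val.map ν ∈ ParallelTensor.parabolicTypes ∧
      ParallelTensor.eulerChar P ν = 0 ∧
      ∀ x : OnePoint ℂ, ∃ m : ℤ, q.ord x = (m : WithTop ℤ) ∧
        ((m = -(k : ℤ) ∧ ν x = ⊤) ∨
          ∃ n ∈ ({1, 2, 3, 4, 6} : Finset ℕ),
            (n : ℤ) * m = -(((n : ℤ) - 1) * (k : ℤ)) ∧ ν x = (n : ℕ∞)) := by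
  have h := ParallelTensor.MeroDifferential.isScaledOrder hf hk hq hlam hpar
  have hset : h.finite.toFinset
      = (ParallelTensor.MeroDifferential.finite_intOrd_ne_zero hq).toFinset := by
    ext x
    simp
  obtain ⟨ν, P, hP, hcan, hpres, htypes, hχ, hord⟩ :=
    ParallelTensor.exists_weight_of_isScaledOrder h (by
      have := ParallelTensor.MeroDifferential.sum_intOrd hq
      rw [hset]
      simp only [sub_add_cancel_right, Finset.sum_neg_distrib]
      omega)
  refine ⟨ν, P, hP, hcan, hpres, htypes, hχ, fun x =>
    ⟨q.intOrd x, ParallelTensor.MeroDifferential.coe_intOrd hq x, ?_⟩⟩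
  rcases hord x with ⟨h0, hν⟩ | ⟨n, hn, hnx, hν⟩
  · exact Or.inl ⟨by omega, hν⟩
  · exact Or.inr ⟨n, hn, by linarith, hν⟩
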